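/- All graphs are finite, simple and undirected. For a graph $G=(V,E)$ and $x,z\in V$ put $A(x,z)=1$ if $x$ and $z$ are adjacent and $A(x,z)=0$ otherwise. A vertex $y\in V$ is a function of vertices $x_1,\ldots,x_k\in V\setminus\{y\}$ ($k\ge 0$) if there is a Boolean function $g$ of $k$ variables such that $A(y,z)=g(A(x_1,z),\ldots,A(x_k,z))$ for every $z\in V\setminus\{y,x_1,\ldots,x_k\}$. The functionality $\mathrm{fun}_G(y)$ of $y$ in $G$ is the least $k$ such that $y$ is a function of some $k$ vertices, and the functionality of $G$ is $\mathrm{fun}(G)=\max_H\min_{y\in V(H)}\mathrm{fun}_H(y)$, where $H$ runs over the induced subgraphs of $G$ with at least one vertex. The VC-dimension $\mathrm{vc}(G)$ of $G$ is the largest cardinality of a set $A\subseteq V$ that is shattered by the closed neighbourhoods of $G$, that is, such that for every $B\subseteq A$ there is a vertex $v\in V$ with $A\cap N[v]=B$, where $N[v]$ consists of $v$ and its neighbours. (Both parameters are taken to be $0$ for the graph without vertices.) Theorem. There exists a function $f:\mathbb{N}\to\mathbb{N}$ such that $\mathrm{vc}(G)\le f(\mathrm{fun}(G))$ for every graph $G$.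 -/

import Mathlib

namespace SimpleGraph

open Classical in
/-- The vertex `y` is a function of the vertices `x 0, …, x (k - 1)`, all different from `y`: there
is a Boolean function `f` of `k` variables such that `A(y,z) = f(A(x 0,z), …, A(x (k - 1),z))` for
every vertex `z` outside `{y, x 0, …, x (k - 1)}`, where `A` is the adjacency matrix of `G`. -/
def IsFunctionOf {V : Type*} (G : SimpleGraph V) (y : V) {k : ℕ} (x : Fin k → V) : Prop :=
  (∀ i, x i ≠ y) ∧
    ∃ f : (Fin k → Bool) → Bool, ∀ z : V, z ≠ y → (∀ i, z ≠ x i) →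
      decide (G.Adj y z) = f (fun i => decide (G.Adj (x i) z))

/-- The functionality of a vertex `y`: the least `k` such that `y` is a function of `k` vertices. -/
noncomputable def vertexFunctionality {V : Type*} (G : SimpleGraph V) (y : V) : ℕ :=
  sInf {k : ℕ | ∃ x : Fin k → V, G.IsFunctionOf y x}

/-- In a finite graph every vertex is a function of all the other vertices, so that the infimum
defining its functionality is a minimum. -/
theorem exists_isFunctionOf_vertexFunctionality {V : Type*} [Finite V] (G : SimpleGraph V) (y : V) :
    ∃ x : Fin (G.vertexFunctionality y) → V, G.IsFunctionOf y x := by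
  have hne : {k : ℕ | ∃ x : Fin k → V, G.IsFunctionOf y x}.Nonempty := by
    obtain ⟨n, ⟨e⟩⟩ := Finite.exists_equiv_fin {w : V // w ≠ y}
    refine ⟨n, fun i => (e.symm i : V), fun i => (e.symm i).2, fun _ => false, ?_⟩
    intro z hz hzx
    exact absurd (by simp) (hzx (e ⟨z, hz⟩))
  exact Nat.sInf_mem hne

open Classical in
/-- The functionality of a finite graph: the maximum, over all (nonempty) induced subgraphs `H`, of
the minimum of the functionalities in `H` of the vertices of `H`. It is `0` for the graph without
vertices. -/
noncomputable def functionality {V : Type*} [Fintype V] (G : SimpleGraph V) : ℕ :=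
  (Finset.univ.filter (fun S : Finset V => S.Nonempty)).sup
    (fun S => ⨅ y : (S : Set V), (G.induce (S : Set V)).vertexFunctionality y)

open Classical in
/-- The closed neighbourhood `N[v]`: the vertex `v` and its neighbours. -/
noncomputable def closedNeighborhood {V : Type*} [Fintype V] (G : SimpleGraph V) (v : V) :
    Finset V :=
  Finset.univ.filter (fun w => w = v ∨ G.Adj v w)

open Classical in
/-- The VC-dimension of a finite graph: the VC-dimension of the family of closed neighbourhoods of
its vertices. It is `0` for the graph without vertices. -/
noncomputable def vc {V : Type*} [Fintype V] (G : SimpleGraph V) : ℕ :=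
  (Finset.univ.image (fun v : V => G.closedNeighborhood v)).vcDim

end SimpleGraph

/-! If the closed neighbourhoods of `G` shatter a large set of vertices, then `G` contains, as an
induced subgraph, the incidence graph of the points and the non-vertical lines of an affine plane over
a large prime field, up to making each of its two sides complete; such a graph has large functionality.

*Finding the plane.* Ramsey's theorem, applied inside the shattered set, gives a shattered set which
is a clique or an independent set, of size `2 ^ m` and so indexed by the subsets `T` of an `m`-set:
its elements are vertices `a T`. For each `i` in the `m`-set, shattering provides a vertex `v i` that
is adjacent to `a T` exactly when `i ∈ T`. Ramsey's theorem, applied to the `v i`, makes them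
homogeneous too, and all subsets of the remaining ones are still realised by vertices `a T`. Hence any
set system on them can be realised, in particular the lines of an affine plane
(`exists_plane_of_shatters`).

*Its functionality.* Let `y` be a line and `x 1, …, x k` other vertices. Since all points are
alike with respect to a point among the `x i`, it suffices to find two points, one on `y` and one off
`y`, that lie on none of the lines among the `x i` and are none of the points among them. Each `x i`
rules out at most one point of the line `y`, since two lines meet at most once, and at most one point
of a vertical line, which also meets `y` only once; so both points exist when the field has
at least `k + 2` elements (`IsPlane.not_isFunctionOf`). The parametrisation `s * a = t + b` of the
incidence of the line `(s, t)` with the point `(a, b)` is symmetric, so that the same applies to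
points. -/

namespace SimpleGraph

/-! ### Ramsey's theorem -/

/-- The elements of `t` are pairwise adjacent or pairwise non-adjacent. -/
def IsHomogeneous {V : Type*} (G : SimpleGraph V) (t : Set V) : Prop :=
  ∃ P : Prop, ∀ a ∈ t, ∀ b ∈ t, a ≠ b → (G.Adj a b ↔ P)

theorem IsHomogeneous.mono {V : Type*} {G : SimpleGraph V} {s t : Set V} (h : s ⊆ t)
    (ht : G.IsHomogeneous t) : G.IsHomogeneous s :=
  ht.imp fun _ hP a ha b hb => hP a (h ha) b (h hb)

/-- Ramsey's theorem with a clique of size `m` and an independent set of size `n`. -/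
theorem exists_ramsey_bound (m n : ℕ) : ∃ N : ℕ, ∀ {V : Type*} (G : SimpleGraph V) (s : Finset V),
    N ≤ s.card → ∃ t ⊆ s, (t.card = m ∧ ∀ a ∈ t, ∀ b ∈ t, a ≠ b → G.Adj a b) ∨
      (t.card = n ∧ ∀ a ∈ t, ∀ b ∈ t, a ≠ b → ¬ G.Adj a b) := by
  classical
  induction m generalizing n with
  | zero => exact ⟨0, fun G s _ => ⟨∅, by simp, by simp⟩⟩
  | succ m ihm =>
    induction n with
    | zero => exact ⟨0, fun G s _ => ⟨∅, by simp, by simp⟩⟩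
    | succ n ihn =>
      obtain ⟨N₁, h₁⟩ := ihm (n + 1)
      obtain ⟨N₂, h₂⟩ := ihn
      refine ⟨N₁ + N₂ + 1, fun {V} G s hs => ?_⟩
      obtain ⟨v, hv⟩ : s.Nonempty := Finset.card_pos.1 (by omega)
      have hcard := Finset.card_filter_add_card_filter_not (s := s.erase v) (fun w => G.Adj v w)
      rw [Finset.card_erase_of_mem hv] at hcard
      rcases le_or_gt N₁ ((s.erase v).filter (fun w => G.Adj v w)).card with h | h
      · obtain ⟨t, hts, ⟨hc, ht⟩ | ⟨hc, ht⟩⟩ := h₁ G _ h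
        · have hmem : ∀ w ∈ t, w ≠ v ∧ w ∈ s ∧ G.Adj v w := fun w hw => by
            simpa [and_assoc] using hts hw
          refine ⟨insert v t, ?_, Or.inl ⟨?_, ?_⟩⟩
          · exact Finset.insert_subset hv fun w hw => (hmem w hw).2.1
          · rw [Finset.card_insert_of_notMem fun h => (hmem v h).1 rfl, hc]
          · intro a ha b hb hab
            rcases Finset.mem_insert.1 ha with rfl | hat <;>
              rcases Finset.mem_insert.1 hb with rfl | hbt
            · exact absurd rfl hab
            · exact (hmem b hbt).2.2
            · exact (hmem a hat).2.2.symm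
            · exact ht a hat b hbt hab
        · exact ⟨t, hts.trans ((Finset.filter_subset _ _).trans (Finset.erase_subset _ _)),
            Or.inr ⟨hc, ht⟩⟩
      · obtain ⟨t, hts, ⟨hc, ht⟩ | ⟨hc, ht⟩⟩ :=
          h₂ G ((s.erase v).filter (fun w => ¬ G.Adj v w)) (by omega)
        · exact ⟨t, hts.trans ((Finset.filter_subset _ _).trans (Finset.erase_subset _ _)),
            Or.inl ⟨hc, ht⟩⟩
        · have hmem : ∀ w ∈ t, w ≠ v ∧ w ∈ s ∧ ¬ G.Adj v w := fun w hw => by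
            simpa [and_assoc] using hts hw
          refine ⟨insert v t, ?_, Or.inr ⟨?_, ?_⟩⟩
          · exact Finset.insert_subset hv fun w hw => (hmem w hw).2.1
          · rw [Finset.card_insert_of_notMem fun h => (hmem v h).1 rfl, hc]
          · intro a ha b hb hab
            rcases Finset.mem_insert.1 ha with rfl | hat <;>
              rcases Finset.mem_insert.1 hb with rfl | hbt
            · exact absurd rfl hab
            · exact (hmem b hbt).2.2
            · exact fun h => (hmem a hat).2.2 h.symm
            · exact ht a hat b hbt hab

theorem exists_isHomogeneous_bound (n : ℕ) : ∃ N : ℕ, ∀ {V : Type*} (G : SimpleGraph V)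
    (s : Finset V), N ≤ s.card → ∃ t ⊆ s, t.card = n ∧ G.IsHomogeneous (t : Set V) := by
  obtain ⟨N, hN⟩ := exists_ramsey_bound n n
  refine ⟨N, fun G s hs => ?_⟩
  obtain ⟨t, hts, ⟨hc, ht⟩ | ⟨hc, ht⟩⟩ := hN G s hs
  · exact ⟨t, hts, hc, True, fun a ha b hb hab => iff_true_intro (ht a ha b hb hab)⟩
  · exact ⟨t, hts, hc, False, fun a ha b hb hab => iff_false_intro (ht a ha b hb hab)⟩

/-! ### Planes and their functionality -/

/-- The vertices `r l`, for lines `l`, and `c q`, for points `q`, induce in `G` the incidence graph of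
the non-vertical lines and the points of the affine plane over `F`, except that the set of lines and
the set of points are each allowed to be a clique. The line `l` is `{q | l.1 * q.1 = l.2 + q.2}`, a
parametrisation in which lines and points have symmetric roles. -/
structure IsPlane {V F : Type*} [Field F] (G : SimpleGraph V) (r c : F × F → V) : Prop where
  injective_left : Function.Injective r
  injective_right : Function.Injective c
  ne : ∀ l q, r l ≠ c q
  adj_iff : ∀ l q, G.Adj (r l) (c q) ↔ l.1 * q.1 = l.2 + q.2
  homogeneous_left : G.IsHomogeneous (Set.range r)
  homogeneous_right : G.IsHomogeneous (Set.range c)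

theorem IsPlane.symm {V F : Type*} [Field F] {G : SimpleGraph V} {r c : F × F → V}
    (h : G.IsPlane r c) : G.IsPlane c r where
  injective_left := h.injective_right
  injective_right := h.injective_left
  ne l q := (h.ne q l).symm
  adj_iff l q := by rw [G.adj_comm, h.adj_iff, mul_comm, add_comm]
  homogeneous_left := h.homogeneous_right
  homogeneous_right := h.homogeneous_left

theorem IsPlane.not_isFunctionOf {V F : Type*} [Field F] [Fintype F] {G : SimpleGraph V}
    {r c : F × F → V} (h : G.IsPlane r c) (hcover : ∀ v, v ∈ Set.range r ∨ v ∈ Set.range c)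
    (l : F × F) {k : ℕ} (hk : k + 2 ≤ Fintype.card F) (x : Fin k → V) :
    ¬ G.IsFunctionOf (r l) x := by
  rintro ⟨hx, f, hf⟩
  -- A point of the line `l` that is neither an `x i` nor on a line `x i`: each `x i` excludes at
  -- most one.
  obtain ⟨q, hql, hqx, hqa⟩ : ∃ q : F × F, l.1 * q.1 = l.2 + q.2 ∧ (∀ i, c q ≠ x i) ∧
      ∀ i l', x i = r l' → ¬ l'.1 * q.1 = l'.2 + q.2 := by
    by_contra! hcon
    have hbad : ∀ a : F, ∃ i, x i = c (a, l.1 * a - l.2) ∨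
        ∃ l', x i = r l' ∧ l'.1 * a = l'.2 + (l.1 * a - l.2) := by
      intro a
      by_cases hc : ∀ i, c (a, l.1 * a - l.2) ≠ x i
      · obtain ⟨i, l', h1, h2⟩ := hcon (a, l.1 * a - l.2) (by ring) hc
        exact ⟨i, Or.inr ⟨l', h1, h2⟩⟩
      · push Not at hc
        exact hc.imp fun i hi => Or.inl hi.symm
    choose g hg using hbad
    have hinj : Function.Injective g := by
      intro a a' haa
      have h1 := hg a
      have h2 := hg a'
      rw [← haa] at h2
      rcases h1 with h1 | ⟨l₁, h1, e1⟩ <;> rcases h2 with h2 | ⟨l₂, h2, e2⟩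
      · exact congrArg Prod.fst (h.injective_right (h1.symm.trans h2))
      · exact absurd (h2.symm.trans h1) (h.ne _ _)
      · exact absurd (h1.symm.trans h2) (h.ne _ _)
      · obtain rfl := h.injective_left (h1.symm.trans h2)
        have hz : (l₁.1 - l.1) * (a - a') = 0 := by linear_combination e1 - e2
        rcases mul_eq_zero.1 hz with hz | hz
        · exfalso
          refine hx (g a) (h1.trans (congrArg r (Prod.ext (sub_eq_zero.1 hz) ?_)))
          linear_combination a * hz - e1
        · exact sub_eq_zero.1 hz
    have := Fintype.card_le_of_injective g hinj
    rw [Fintype.card_fin] at this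
    omega
  -- A point of the vertical line through the origin that is neither on `l`, nor an `x i`, nor on a
  -- line `x i`: again each condition excludes at most one.
  obtain ⟨q', hql', hqx', hqa'⟩ : ∃ q : F × F, ¬ l.1 * q.1 = l.2 + q.2 ∧ (∀ i, c q ≠ x i) ∧
      ∀ i l', x i = r l' → ¬ l'.1 * q.1 = l'.2 + q.2 := by
    by_contra! hcon
    have hbad : ∀ b : F, ∃ o : Option (Fin k), o.elim (r l) x = c (0, b) ∨
        ∃ l', o.elim (r l) x = r l' ∧ l'.1 * 0 = l'.2 + b := by
      intro b
      by_cases hl : l.1 * 0 = l.2 + b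
      · exact ⟨none, Or.inr ⟨l, rfl, hl⟩⟩
      by_cases hc : ∀ i, c (0, b) ≠ x i
      · obtain ⟨i, l', h1, h2⟩ := hcon (0, b) hl hc
        exact ⟨some i, Or.inr ⟨l', h1, h2⟩⟩
      · push Not at hc
        obtain ⟨i, hi⟩ := hc
        exact ⟨some i, Or.inl hi.symm⟩
    choose g hg using hbad
    have hinj : Function.Injective g := by
      intro b b' hbb
      have h1 := hg b
      have h2 := hg b'
      rw [← hbb] at h2
      rcases h1 with h1 | ⟨l₁, h1, e1⟩ <;> rcases h2 with h2 | ⟨l₂, h2, e2⟩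
      · exact congrArg Prod.snd (h.injective_right (h1.symm.trans h2))
      · exact absurd (h2.symm.trans h1) (h.ne _ _)
      · exact absurd (h1.symm.trans h2) (h.ne _ _)
      · obtain rfl := h.injective_left (h1.symm.trans h2)
        linear_combination e2 - e1
    have := Fintype.card_le_of_injective g hinj
    rw [Fintype.card_option, Fintype.card_fin] at this
    omega
  have hrow : ∀ i, (G.Adj (x i) (c q) ↔ G.Adj (x i) (c q')) := by
    intro i
    rcases hcover (x i) with ⟨l', hl'⟩ | ⟨p, hp⟩
    · rw [← hl', h.adj_iff, h.adj_iff]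
      exact iff_of_false (hqa i l' hl'.symm) (hqa' i l' hl'.symm)
    · obtain ⟨P, hP⟩ := h.homogeneous_right
      rw [hP (x i) ⟨p, hp⟩ (c q) ⟨q, rfl⟩ (hqx i).symm,
        hP (x i) ⟨p, hp⟩ (c q') ⟨q', rfl⟩ (hqx' i).symm]
  have h1 := hf (c q) (h.ne l q).symm hqx
  have h2 := hf (c q') (h.ne l q').symm hqx'
  have h3 := h1.trans ((congrArg f (funext fun i => decide_eq_decide.2 (hrow i))).trans h2.symm)
  rw [decide_eq_decide, h.adj_iff, h.adj_iff] at h3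
  exact hql' (h3.1 hql)

theorem IsPlane.lt_functionality {V F : Type*} [Fintype V] [Field F] [Fintype F]
    {G : SimpleGraph V} {r c : F × F → V} (h : G.IsPlane r c) {k : ℕ}
    (hk : k + 2 ≤ Fintype.card F) : k < G.functionality := by
  classical
  let S : Finset V := Finset.univ.image r ∪ Finset.univ.image c
  have hr : ∀ l, r l ∈ (S : Set V) := fun l => by simp [S]
  have hc : ∀ q, c q ∈ (S : Set V) := fun q => by simp [S]
  let r' : F × F → (S : Set V) := fun l => ⟨r l, hr l⟩
  let c' : F × F → (S : Set V) := fun q => ⟨c q, hc q⟩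
  have h' : (G.induce (S : Set V)).IsPlane r' c' :=
    { injective_left := fun a b hab => h.injective_left (congrArg Subtype.val hab)
      injective_right := fun a b hab => h.injective_right (congrArg Subtype.val hab)
      ne := fun l q hlq => h.ne l q (congrArg Subtype.val hlq)
      adj_iff := fun l q => h.adj_iff l q
      homogeneous_left := by
        obtain ⟨P, hP⟩ := h.homogeneous_left
        refine ⟨P, ?_⟩
        rintro _ ⟨a, rfl⟩ _ ⟨b, rfl⟩ hab
        exact hP _ ⟨a, rfl⟩ _ ⟨b, rfl⟩ fun e => hab (Subtype.ext e)
      homogeneous_right := by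
        obtain ⟨P, hP⟩ := h.homogeneous_right
        refine ⟨P, ?_⟩
        rintro _ ⟨a, rfl⟩ _ ⟨b, rfl⟩ hab
        exact hP _ ⟨a, rfl⟩ _ ⟨b, rfl⟩ fun e => hab (Subtype.ext e) }
  have hcover : ∀ v, v ∈ Set.range r' ∨ v ∈ Set.range c' := by
    rintro ⟨v, hv⟩
    rcases Finset.mem_union.1 (Finset.mem_coe.1 hv) with hv | hv
    · obtain ⟨l, -, rfl⟩ := Finset.mem_image.1 hv
      exact Or.inl ⟨l, rfl⟩
    · obtain ⟨q, -, rfl⟩ := Finset.mem_image.1 hv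
      exact Or.inr ⟨q, rfl⟩
  have hfun : ∀ y : (S : Set V), k + 1 ≤ (G.induce (S : Set V)).vertexFunctionality y := by
    intro y
    by_contra! hlt
    obtain ⟨x, hx⟩ := (G.induce (S : Set V)).exists_isFunctionOf_vertexFunctionality y
    rcases hcover y with ⟨l, rfl⟩ | ⟨q, rfl⟩
    · exact h'.not_isFunctionOf hcover l (by omega) x hx
    · exact h'.symm.not_isFunctionOf (fun v => (hcover v).symm) q (by omega) x hx
  have hS : S.Nonempty := ⟨r 0, hr 0⟩
  have : Nonempty (S : Set V) := ⟨r' 0⟩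
  refine lt_of_lt_of_le (Nat.lt_of_succ_le (le_ciInf hfun)) ?_
  exact Finset.le_sup (f := fun S : Finset V =>
    ⨅ y : (S : Set V), (G.induce (S : Set V)).vertexFunctionality y) (by simpa using hS)

/-! ### Planes in graphs of large VC-dimension -/

/-- A homogeneous set shattered by closed neighbourhoods, of size `2 ^ m`, has its elements indexed by
the subsets of `Fin m` so that each `i : Fin m` is represented by a vertex outside the set, adjacent
to exactly those elements whose index contains `i`. -/
theorem exists_dual_of_shattered {V : Type*} [Fintype V] [DecidableEq V] {G : SimpleGraph V}
    {A : Finset V} (hA : ∀ B ⊆ A, ∃ v, A ∩ G.closedNeighborhood v = B)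
    (hhom : G.IsHomogeneous (A : Set V)) {m : ℕ} (hm : 2 ≤ m) (hcard : A.card = 2 ^ m) :
    ∃ (a : Finset (Fin m) → V) (v : Fin m → V), Function.Injective a ∧ (∀ T, a T ∈ A) ∧
      (∀ i, v i ∉ A) ∧ ∀ i T, G.Adj (v i) (a T) ↔ i ∈ T := by
  have e : Finset (Fin m) ≃ A := Fintype.equivOfCardEq (by simp [hcard])
  let a : Finset (Fin m) → V := fun T => e T
  have hinj : Function.Injective a := Subtype.val_injective.comp e.injective
  have haA : ∀ T, a T ∈ A := fun T => (e T).2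
  have hsurj : ∀ w ∈ A, ∃ T, a T = w := fun w hw =>
    ⟨e.symm ⟨w, hw⟩, congrArg Subtype.val (e.apply_symm_apply ⟨w, hw⟩)⟩
  have hv : ∀ i : Fin m, ∃ v, A ∩ G.closedNeighborhood v =
      (Finset.univ.filter (fun T : Finset (Fin m) => i ∈ T)).image a := by
    refine fun i => hA _ fun w hw => ?_
    obtain ⟨T, -, rfl⟩ := Finset.mem_image.1 hw
    exact haA T
  choose v hv using hv
  have hmem : ∀ i T, (a T = v i ∨ G.Adj (v i) (a T)) ↔ i ∈ T := by
    intro i T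
    have := Finset.ext_iff.1 (hv i) (a T)
    simpa [closedNeighborhood, haA T, hinj.eq_iff] using this
  have hvA : ∀ i, v i ∉ A := by
    intro i hi
    obtain ⟨P, hP⟩ := hhom
    obtain ⟨T₀, hT₀⟩ := hsurj _ hi
    have hiT₀ : i ∈ T₀ := (hmem i T₀).1 (Or.inl hT₀)
    have hadj : ∀ T, T ≠ T₀ → (P ↔ i ∈ T) := by
      intro T hT
      have hne : a T ≠ v i := fun h => hT (hinj (h.trans hT₀.symm))
      rw [← hmem i T, or_iff_right hne, hP _ hi _ (haA T) hne.symm]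
    -- The empty set shows that `A` is independent; one of `{i}` and `univ`, that it is a clique.
    have hnP : ¬ P := fun h => by
      simpa using (hadj ∅ (by rintro rfl; simp at hiT₀)).1 h
    by_cases h1 : ({i} : Finset (Fin m)) = T₀
    · refine hnP ((hadj Finset.univ fun h2 => ?_).2 (Finset.mem_univ i))
      have := congrArg Finset.card (h1.trans h2.symm)
      simp at this
      omega
    · exact hnP ((hadj _ h1).2 (Finset.mem_singleton_self i))
  refine ⟨a, v, hinj, haA, hvA, fun i T => ?_⟩
  rw [← hmem i T, or_iff_right]
  intro h
  exact hvA i (h ▸ haA T)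

theorem exists_plane_of_shatters (F : Type*) [Field F] [Fintype F] :
    ∃ N : ℕ, ∀ {V : Type*} [Fintype V] [DecidableEq V] (G : SimpleGraph V) (A : Finset V),
      (∀ B ⊆ A, ∃ v, A ∩ G.closedNeighborhood v = B) → N ≤ A.card →
        ∃ r c : F × F → V, G.IsPlane r c := by
  classical
  obtain ⟨M, hM⟩ := exists_isHomogeneous_bound (Fintype.card (F × F))
  obtain ⟨N, hN⟩ := exists_isHomogeneous_bound (2 ^ (M + 2))
  refine ⟨N, fun {V} _ _ G A hA hcard => ?_⟩
  obtain ⟨A', hA', hcard', hhom⟩ := hN G A hcard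
  have hsh : ∀ B ⊆ A', ∃ v, A' ∩ G.closedNeighborhood v = B := by
    intro B hB
    obtain ⟨v, hv⟩ := hA B (hB.trans hA')
    refine ⟨v, ?_⟩
    rw [← Finset.inter_eq_left.2 hA', Finset.inter_assoc, hv, Finset.inter_eq_right.2 hB]
  obtain ⟨a, v, hinj, haA, hvA, hadj⟩ := exists_dual_of_shattered hsh hhom (by omega) hcard'
  have hvinj : Function.Injective v := by
    intro i j hij
    have := (hadj i {i}).2 (Finset.mem_singleton_self i)
    rw [hij, hadj] at this
    exact (Finset.mem_singleton.1 this).symm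
  obtain ⟨t, ht, htcard, hthom⟩ := hM G (Finset.univ.image v)
    (by rw [Finset.card_image_of_injective _ hvinj]; simp)
  have e : F × F ≃ t := Fintype.equivOfCardEq (by simp [htcard])
  have hu : ∀ q, ∃ i, v i = e q := fun q => by simpa using ht (e q).2
  choose u hu using hu
  have huinj : Function.Injective u := fun q q' h =>
    e.injective (Subtype.ext (by rw [← hu, ← hu, h]))
  let L : F × F → Finset (Fin (M + 2)) := fun l =>
    (Finset.univ.filter fun q : F × F => l.1 * q.1 = l.2 + q.2).image u
  have hL : ∀ l q, u q ∈ L l ↔ l.1 * q.1 = l.2 + q.2 := fun l q => by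
    simp [L, huinj.eq_iff]
  refine ⟨fun l => a (L l), fun q => v (u q), ?_⟩
  refine ⟨?_, hvinj.comp huinj, fun l q h => hvA _ (h ▸ haA _), ?_, ?_, ?_⟩
  · intro l l' hll
    have hLL : L l = L l' := hinj hll
    -- A line is determined by its points with abscissas `0` and `1`.
    have h0 := (hL l (0, -l.2)).2 (by ring)
    have h1 := (hL l (1, l.1 - l.2)).2 (by ring)
    rw [hLL, hL] at h0 h1
    have h2 : l.2 = l'.2 := by linear_combination h0
    exact Prod.ext (by linear_combination -h1 + h2) h2
  · intro l q
    rw [G.adj_comm, hadj, hL]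
  · exact hhom.mono (by rintro _ ⟨l, rfl⟩; exact haA _)
  · exact hthom.mono (by rintro _ ⟨q, rfl⟩; simp only [hu]; exact (e q).2)

open Classical in
theorem exists_shattered_of_lt_vc {V : Type*} [Fintype V] {G : SimpleGraph V}
    {n : ℕ} (h : n < G.vc) :
    ∃ A : Finset V, n < A.card ∧ ∀ B ⊆ A, ∃ v, A ∩ G.closedNeighborhood v = B := by
  obtain ⟨A, hA, hn⟩ := Finset.lt_sup_iff.1 h
  refine ⟨A, hn, fun B hB => ?_⟩
  obtain ⟨u, hu, huB⟩ := Finset.mem_shatterer.1 hA hB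
  obtain ⟨v, -, rfl⟩ := Finset.mem_image.1 hu
  exact ⟨v, huB⟩

theorem exists_lt_functionality_of_lt_vc (k : ℕ) : ∃ N : ℕ, ∀ (V : Type*) [Fintype V]
    (G : SimpleGraph V), N < G.vc → k < G.functionality := by
  classical
  obtain ⟨p, hkp, hp⟩ := Nat.exists_infinite_primes (k + 2)
  have : Fact p.Prime := ⟨hp⟩
  obtain ⟨N, hN⟩ := exists_plane_of_shatters (ZMod p)
  refine ⟨N, fun V _ G hG => ?_⟩
  obtain ⟨A, hNA, hA⟩ := exists_shattered_of_lt_vc hG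
  obtain ⟨r, c, hrc⟩ := hN G A hA hNA.le
  exact hrc.lt_functionality (by rwa [ZMod.card])

end SimpleGraph

theorem theorem8 :
    ∃ f : ℕ → ℕ, ∀ (V : Type*) [Fintype V] (G : SimpleGraph V), G.vc ≤ f G.functionality := by
  choose f hf using SimpleGraph.exists_lt_functionality_of_lt_vc
  exact ⟨f, fun V _ G => not_lt.1 fun h => lt_irrefl _ (hf _ V G h)⟩
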